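/- Let $A$ be a commutative ring (for instance $A=\mathbb{Z}$, or $A=\mathbb{Z}[R]$ with $R$ an indeterminate). For $x,y,N\in A$ write $x\equiv y\pmod N$ when $N$ divides $x-y$ in $A$. For sequences $a_k,b_k,c_k\in A$ define polynomials in $z$ by $P_0=0$, $P_1=1$, $Q_0=1$, $Q_1=1-c_0z$ and, for $h\ge 2$, $$P_h=(1-c_{h-1}z)P_{h-1}-a_{h-2}b_{h-1}z^2P_{h-2},\qquad Q_h=(1-c_{h-1}z)Q_{h-1}-a_{h-2}b_{h-1}z^2Q_{h-2}.$$ Let $J^{[h]}(z)=P_h(z)/Q_h(z)\in A[[z]]$ be the $h$-th convergent of the J-fraction $$J(z)=\cfrac{1}{1-c_0z-\cfrac{a_0b_1z^2}{1-c_1z-\cfrac{a_1b_2z^2}{\cdots}}},$$ where $J(z)\in A[[z]]$ is the coefficientwise limit of the $J^{[h]}(z)$. Put $\lambda_k=a_{k-1}b_k$ for $k\ge1$ and $M_h=\lambda_1\lambda_2\cdots\lambda_h$. (1) The series $J(z)$ exists, and for all $h\ge1$, all $N\in A$ with $N\mid M_h$ and all $n\ge0$, $$[z^n]J(z)\equiv[z^n]J^{[h]}(z)\pmod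 N.$$ (2) Let $\alpha,R\in A$, let $p_n(\alpha,R)=\prod_{0\le j<n}(R+j\alpha)$, and take $$a_k=\alpha(R+k\alpha),\qquad b_k=k,\qquad c_k=R+2k\alpha.$$ Write $\lambda_k(\alpha,R)$, $M_h(\alpha,R)$ and $\mathrm{Conv}_h(\alpha,R;z)$ for the resulting $\lambda_k$, $M_h$ and $J^{[h]}(z)$. Then $J(z)=\sum_{n\ge0}p_n(\alpha,R)z^n$, and for all $k\ge1$ and $h\ge1$, $$\lambda_k(\alpha,R)=\alpha\,(R+(k-1)\alpha)\,k,\qquad M_h(\alpha,R)=\alpha^h\cdot h!\cdot p_h(\alpha,R).$$ Hence, for every $h\ge1$, every $N\in A$ with $N\mid M_h(\alpha,R)$ and every $n\ge0$, $$p_n(\alpha,R)\equiv[z^n]\,\mathrm{Conv}_h(\alpha,R;z)\pmod N.$$ In particular, for $0\le i\le h$ we have $h\alpha^i\mid M_h(\alpha,R)$, so that this congruence holds modulo $h$ and modulo $h\alpha^i$ for every $n\ge 0$. (3) If $\alpha,R\in\mathbb{Q}$, $h\ge1$, $M_h(\alpha,R)\in\mathbb{Z}$ and $N$ is an integer that divides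 $M_h(\alpha,R)$ in $\mathbb{Z}$, then for every $n\ge0$ the congruence $p_n(\alpha,R)\equiv[z^n]\,\mathrm{Conv}_h(\alpha,R;z)\pmod N$ holds in the ring $\mathbb{Z}[\alpha,R]\subseteq\mathbb{Q}$, that is, $$p_n(\alpha,R)-[z^n]\,\mathrm{Conv}_h(\alpha,R;z)\in N\cdot\mathbb{Z}[\alpha,R].$$ -/

import Mathlib

/-! Jacobi-type continued fractions (J-fractions)
`1 / (1 - c₀ z - a₀ b₁ z² / (1 - c₁ z - a₁ b₂ z² / (1 - c₂ z - ⋯)))`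
over a commutative ring, and the special case that generates the generalized factorial products. -/

/-- Numerator of the `h`-th convergent of the J-fraction with parameters `a`, `b`, `c`. -/
noncomputable def jNum {A : Type*} [CommRing A] (a b c : ℕ → A) : ℕ → Polynomial A
  | 0 => 0
  | 1 => 1
  | h + 2 => (1 - Polynomial.C (c (h + 1)) * Polynomial.X) * jNum a b c (h + 1)
      - Polynomial.C (a h * b (h + 1)) * Polynomial.X ^ 2 * jNum a b c h

/-- Denominator of the `h`-th convergent of the J-fraction with parameters `a`, `b`, `c`. -/
noncomputable def jDen {A : Type*} [CommRing A] (a b c : ℕ → A) : ℕ → Polynomial A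
  | 0 => 1
  | 1 => 1 - Polynomial.C (c 0) * Polynomial.X
  | h + 2 => (1 - Polynomial.C (c (h + 1)) * Polynomial.X) * jDen a b c (h + 1)
      - Polynomial.C (a h * b (h + 1)) * Polynomial.X ^ 2 * jDen a b c h

/-- The `h`-th convergent, numerator over denominator, as a formal power series. The denominator has
constant coefficient `1`, so that it is invertible (`jDen_constantCoeff`, `jConv_mul_jDen`). -/
noncomputable def jConv {A : Type*} [CommRing A] (a b c : ℕ → A) (h : ℕ) : PowerSeries A :=
  (jNum a b c h : PowerSeries A) * PowerSeries.invOfUnit (jDen a b c h : PowerSeries A) 1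

theorem jDen_constantCoeff {A : Type*} [CommRing A] (a b c : ℕ → A) :
    ∀ h : ℕ, PowerSeries.constantCoeff (jDen a b c h : PowerSeries A) = 1
  | 0 => by simp [jDen]
  | 1 => by simp [jDen]
  | h + 2 => by
      have := jDen_constantCoeff a b c (h + 1)
      simp [jDen] at this ⊢
      exact this

theorem jConv_mul_jDen {A : Type*} [CommRing A] (a b c : ℕ → A) (h : ℕ) :
    jConv a b c h * (jDen a b c h : PowerSeries A) = (jNum a b c h : PowerSeries A) := by
  have := PowerSeries.mul_invOfUnit (jDen a b c h : PowerSeries A) 1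
    (by rw [jDen_constantCoeff]; rfl)
  rw [jConv, mul_assoc, mul_comm (PowerSeries.invOfUnit _ _), this, mul_one]

/-- `F` is the formal power series expansion of the infinite J-fraction: every coefficient of `F` is
the eventual value of the corresponding coefficient of the convergents. -/
def IsJFraction {A : Type*} [CommRing A] (a b c : ℕ → A) (F : PowerSeries A) : Prop :=
  ∀ n : ℕ, ∀ᶠ h in Filter.atTop, PowerSeries.coeff n (jConv a b c h) = PowerSeries.coeff n F

theorem IsJFraction.unique {A : Type*} [CommRing A] {a b c : ℕ → A} {F G : PowerSeries A}
    (hF : IsJFraction a b c F) (hG : IsJFraction a b c G) : F = G := by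
  ext n
  obtain ⟨h, h1, h2⟩ := ((hF n).and (hG n)).exists
  exact h1.symm.trans h2

/-- `λ_k = a_{k-1} b_k`, for `k ≥ 1`. -/
def jLam {A : Type*} [CommRing A] (a b : ℕ → A) (k : ℕ) : A := a (k - 1) * b k

/-- `M_h = λ_1 λ_2 ⋯ λ_h`. -/
def jM {A : Type*} [CommRing A] (a b : ℕ → A) (h : ℕ) : A := ∏ k ∈ Finset.Icc 1 h, jLam a b k

/-- The product sequence `p_n(α, R) = R (R + α) ⋯ (R + (n - 1) α)`, with `p_0 = 1`; it is also
written `(R)_{n,α}` (the Pochhammer `α`-symbol). -/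
def genProd {A : Type*} [CommRing A] (n : ℕ) (α R : A) : A :=
  ∏ j ∈ Finset.range n, (R + (j : A) * α)

/-! The parameters of the J-fraction that generates `p_n(α, R)`. -/

def aPar {A : Type*} [CommRing A] (α R : A) (k : ℕ) : A := α * (R + (k : A) * α)

def bPar (A : Type*) [CommRing A] (k : ℕ) : A := (k : A)

def cPar {A : Type*} [CommRing A] (α R : A) (k : ℕ) : A := R + 2 * (k : A) * α

/-- `λ_k(α, R)`. -/
def lamPar {A : Type*} [CommRing A] (α R : A) (k : ℕ) : A := jLam (aPar α R) (bPar A) k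

/-- `M_h(α, R)`. -/
def MPar {A : Type*} [CommRing A] (α R : A) (h : ℕ) : A := jM (aPar α R) (bPar A) h

/-- `FP_h(α, R; z)`. -/
noncomputable def FP {A : Type*} [CommRing A] (h : ℕ) (α R : A) : Polynomial A :=
  jNum (aPar α R) (bPar A) (cPar α R) h

/-- `FQ_h(α, R; z)`. -/
noncomputable def FQ {A : Type*} [CommRing A] (h : ℕ) (α R : A) : Polynomial A :=
  jDen (aPar α R) (bPar A) (cPar α R) h

/-- `Conv_h(α, R; z) = FP_h(α, R; z) / FQ_h(α, R; z)`. -/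
noncomputable def Conv {A : Type*} [CommRing A] (h : ℕ) (α R : A) : PowerSeries A :=
  jConv (aPar α R) (bPar A) (cPar α R) h

/-! The recurrence relations of `FP` and `FQ`, written out. -/

theorem FP_recurrence {A : Type*} [CommRing A] (α R : A) :
    FP 0 α R = 0 ∧ FP 1 α R = 1 ∧ ∀ h : ℕ, 2 ≤ h →
      FP h α R = (1 - Polynomial.C (R + 2 * α * ((h : A) - 1)) * Polynomial.X) * FP (h - 1) α R
        - Polynomial.C (α * (R + α * ((h : A) - 2)) * ((h : A) - 1)) * Polynomial.X ^ 2
          * FP (h - 2) α R := by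
  refine ⟨rfl, rfl, fun h hh => ?_⟩
  obtain ⟨m, rfl⟩ := Nat.exists_eq_add_of_le' hh
  simp only [FP, Nat.add_sub_cancel, show m + 2 - 1 = m + 1 by omega]
  rw [jNum]
  simp only [aPar, bPar, cPar]
  congr 3
  · congr 2
    push_cast
    ring
  · congr 1
    push_cast
    ring

theorem FQ_recurrence {A : Type*} [CommRing A] (α R : A) :
    FQ 0 α R = 1 ∧ FQ 1 α R = 1 - Polynomial.C R * Polynomial.X ∧ ∀ h : ℕ, 2 ≤ h →
      FQ h α R = (1 - Polynomial.C (R + 2 * α * ((h : A) - 1)) * Polynomial.X) * FQ (h - 1) α R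
        - Polynomial.C (α * (R + α * ((h : A) - 2)) * ((h : A) - 1)) * Polynomial.X ^ 2
          * FQ (h - 2) α R := by
  refine ⟨rfl, by simp [FQ, jDen, cPar], fun h hh => ?_⟩
  obtain ⟨m, rfl⟩ := Nat.exists_eq_add_of_le' hh
  simp only [FQ, Nat.add_sub_cancel, show m + 2 - 1 = m + 1 by omega]
  rw [jDen]
  simp only [aPar, bPar, cPar]
  congr 3
  · congr 2
    push_cast
    ring
  · congr 1
    push_cast
    ring

/-! The denominators are units in `A[[z]]`, so the determinant formula `jNum_mul_jDen_sub` makes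
consecutive convergents differ by `M_h z^(2h)` times a power series. The factor `z^(2h)` forces the
coefficients to stabilise; the factor `M_h`, which divides every later `M_k`, gives the congruences
after telescoping.

For the products `p_n`, the remainder `J Q_h - P_h` has the closed form `genRemainder`: it obeys the
recurrence of `P_h` and `Q_h` with the right initial values. It vanishes to order `2h`, so `J` is
the limit of the convergents.

The rational case is the general one over the ring `ℤ[α, R]`, mapped into `ℚ`. -/

theorem jM_succ {A : Type*} [CommRing A] (a b : ℕ → A) (h : ℕ) :
    jM a b (h + 1) = jM a b h * (a h * b (h + 1)) := by
  rw [jM, Finset.prod_Icc_succ_top (by omega)]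
  rfl

theorem jM_dvd_jM {A : Type*} [CommRing A] (a b : ℕ → A) {h k : ℕ} (hk : h ≤ k) :
    jM a b h ∣ jM a b k :=
  Finset.prod_dvd_prod_of_subset _ _ _ (Finset.Icc_subset_Icc_right hk)

/-- The determinant formula for consecutive convergents. -/
theorem jNum_mul_jDen_sub {A : Type*} [CommRing A] (a b c : ℕ → A) (h : ℕ) :
    jNum a b c (h + 1) * jDen a b c h - jNum a b c h * jDen a b c (h + 1) =
      Polynomial.C (jM a b h) * Polynomial.X ^ (2 * h) := by
  induction h with
  | zero => simp [jNum, jDen, jM]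
  | succ h ih =>
    rw [jM_succ, Polynomial.C_mul, jNum, jDen]
    linear_combination (Polynomial.C (a h * b (h + 1)) * Polynomial.X ^ 2) * ih

theorem isUnit_jDen {A : Type*} [CommRing A] (a b c : ℕ → A) (h : ℕ) :
    IsUnit (jDen a b c h : PowerSeries A) := by
  rw [PowerSeries.isUnit_iff_constantCoeff, jDen_constantCoeff]
  exact isUnit_one

theorem jConv_succ_sub {A : Type*} [CommRing A] (a b c : ℕ → A) (h : ℕ) :
    ∃ G : PowerSeries A, jConv a b c (h + 1) - jConv a b c h =
      PowerSeries.X ^ (2 * h) * (PowerSeries.C (jM a b h) * G) := by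
  obtain ⟨u, hu⟩ := (isUnit_jDen a b c h).mul (isUnit_jDen a b c (h + 1))
  refine ⟨(↑u⁻¹ : PowerSeries A), ?_⟩
  have hdet := congrArg (fun p : Polynomial A => (p : PowerSeries A)) (jNum_mul_jDen_sub a b c h)
  simp only [Polynomial.coe_sub, Polynomial.coe_mul, Polynomial.coe_C, Polynomial.coe_pow,
    Polynomial.coe_X] at hdet
  -- Clearing the unit `Q_h Q_{h+1}` leaves the determinant formula.
  rw [← mul_assoc, Units.eq_mul_inv_iff_mul_eq, hu]
  linear_combination hdet + (jDen a b c h : PowerSeries A) * jConv_mul_jDen a b c (h + 1)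
    - (jDen a b c (h + 1) : PowerSeries A) * jConv_mul_jDen a b c h

theorem jM_dvd_coeff_jConv_sub {A : Type*} [CommRing A] (a b c : ℕ → A) {h k : ℕ} (hk : h ≤ k)
    (n : ℕ) : jM a b h ∣
      PowerSeries.coeff n (jConv a b c k) - PowerSeries.coeff n (jConv a b c h) := by
  induction k, hk using Nat.le_induction with
  | base => simp
  | succ k hk ih =>
    rw [← sub_add_sub_cancel _ (PowerSeries.coeff n (jConv a b c k))]
    refine dvd_add ((jM_dvd_jM a b hk).trans ?_) ih
    obtain ⟨G, hG⟩ := jConv_succ_sub a b c k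
    rw [← map_sub, hG, mul_left_comm, PowerSeries.coeff_C_mul]
    exact dvd_mul_right _ _

theorem coeff_jConv_eq {A : Type*} [CommRing A] (a b c : ℕ → A) {n h k : ℕ} (hn : n < 2 * h)
    (hk : h ≤ k) :
    PowerSeries.coeff n (jConv a b c k) = PowerSeries.coeff n (jConv a b c h) := by
  induction k, hk using Nat.le_induction with
  | base => rfl
  | succ k hk ih =>
    obtain ⟨G, hG⟩ := jConv_succ_sub a b c k
    rw [← ih, ← sub_eq_zero, ← map_sub, hG, PowerSeries.coeff_X_pow_mul', if_neg (by omega)]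

theorem exists_isJFraction {A : Type*} [CommRing A] (a b c : ℕ → A) :
    ∃ F : PowerSeries A, IsJFraction a b c F := by
  refine ⟨PowerSeries.mk fun n => PowerSeries.coeff n (jConv a b c (n + 1)), fun n => ?_⟩
  filter_upwards [Filter.eventually_ge_atTop (n + 1)] with k hk
  rw [PowerSeries.coeff_mk]
  exact coeff_jConv_eq a b c (by omega) hk

theorem IsJFraction.jM_dvd {A : Type*} [CommRing A] {a b c : ℕ → A} {F : PowerSeries A}
    (hF : IsJFraction a b c F) (h n : ℕ) :
    jM a b h ∣ PowerSeries.coeff n F - PowerSeries.coeff n (jConv a b c h) := by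
  obtain ⟨k, hk, hhk⟩ := ((hF n).and (Filter.eventually_ge_atTop h)).exists
  rw [← hk]
  exact jM_dvd_coeff_jConv_sub a b c hhk n

/-! ### The J-fraction of the generalized products. -/

theorem genProd_succ {A : Type*} [CommRing A] (n : ℕ) (α R : A) :
    genProd (n + 1) α R = genProd n α R * (R + (n : A) * α) :=
  Finset.prod_range_succ _ _

theorem lamPar_eq {A : Type*} [CommRing A] (α R : A) {k : ℕ} (hk : 1 ≤ k) :
    lamPar α R k = α * (R + ((k : A) - 1) * α) * (k : A) := by
  simp [lamPar, jLam, aPar, bPar, Nat.cast_sub hk]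

theorem MPar_eq {A : Type*} [CommRing A] (α R : A) (h : ℕ) :
    MPar α R h = α ^ h * (h.factorial : A) * genProd h α R := by
  induction h with
  | zero => simp [MPar, jM, genProd]
  | succ h ih =>
    rw [MPar, jM_succ, ← MPar, ih, genProd_succ, Nat.factorial_succ, aPar, bPar]
    push_cast
    ring

theorem mul_pow_dvd_MPar {A : Type*} [CommRing A] (α R : A) {h i : ℕ} (hh : 1 ≤ h) (hi : i ≤ h) :
    (h : A) * α ^ i ∣ MPar α R h := by
  rw [MPar_eq, mul_comm (h : A)]
  exact (mul_dvd_mul (pow_dvd_pow α hi)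
    (Nat.cast_dvd_cast (Nat.dvd_factorial hh le_rfl))).mul_right _

/-- Subtraction in the ring may replace truncated subtraction: for `s < h` both descending
factorials vanish. -/
theorem cast_descFactorial_succ {A : Type*} [CommRing A] (s h : ℕ) :
    (s.descFactorial (h + 1) : A) = ((s : A) - h) * s.descFactorial h := by
  rcases le_or_gt h s with hs | hs
  · rw [Nat.descFactorial_succ, Nat.cast_mul, Nat.cast_sub hs]
  · rw [Nat.descFactorial_of_lt hs, Nat.descFactorial_of_lt (by omega)]
    simp

/-- The remainder `J(z) FQ_h(z) - FP_h(z)` for the generating function `J` of `p_n(α, R)`. -/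
noncomputable def genRemainder {A : Type*} [CommRing A] (α R : A) (h : ℕ) : PowerSeries A :=
  PowerSeries.mk fun n => α ^ h * ((n - h).descFactorial h : A) * genProd (n - h) α R

theorem genRemainder_add_two {A : Type*} [CommRing A] (α R : A) (h : ℕ) :
    genRemainder α R (h + 2) =
      (1 - PowerSeries.C (cPar α R (h + 1)) * PowerSeries.X) * genRemainder α R (h + 1)
      - PowerSeries.C (aPar α R h * bPar A (h + 1)) * PowerSeries.X ^ 2 * genRemainder α R h := by
  ext n
  rw [sub_mul, one_mul, mul_assoc, mul_assoc, map_sub, map_sub, PowerSeries.coeff_C_mul,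
    PowerSeries.coeff_C_mul]
  rcases Nat.lt_or_ge n (h + 2) with hn | hn
  -- In this range every descending factorial involved is zero, so truncation in the indices does no
  -- harm.
  · have hX : PowerSeries.coeff n (PowerSeries.X * genRemainder α R (h + 1)) = 0 := by
      rcases n with _ | n
      · simp
      · rw [PowerSeries.coeff_succ_X_mul, genRemainder, PowerSeries.coeff_mk,
          Nat.descFactorial_of_lt (by omega)]
        simp
    have hX2 : PowerSeries.coeff n (PowerSeries.X ^ 2 * genRemainder α R h) = 0 := by
      rw [PowerSeries.coeff_X_pow_mul']
      split_ifs with h2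
      · rw [genRemainder, PowerSeries.coeff_mk, Nat.descFactorial_of_lt (by omega)]
        simp
      · rfl
    rw [hX, hX2, genRemainder, genRemainder, PowerSeries.coeff_mk, PowerSeries.coeff_mk,
      Nat.descFactorial_of_lt (by omega), Nat.descFactorial_of_lt (by omega)]
    simp
  · obtain ⟨s, rfl⟩ := Nat.exists_eq_add_of_le' hn
    rw [show s + (h + 2) = s + h + 1 + 1 by ring, PowerSeries.coeff_succ_X_mul,
      PowerSeries.coeff_X_pow_mul', if_pos (by omega)]
    simp only [genRemainder, PowerSeries.coeff_mk]
    -- All terms become multiples of `α^(h+1) * s.descFactorial h * genProd s α R`; a polynomial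
    -- identity in `s`, `h`, `α`, `R` remains.
    rw [show s + h + 1 + 1 - (h + 2) = s by omega, show s + h + 1 + 1 - (h + 1) = s + 1 by omega,
      show s + h + 1 - (h + 1) = s by omega, show s + h + 1 + 1 - 2 - h = s by omega,
      Nat.succ_descFactorial_succ, genProd_succ, cast_descFactorial_succ s (h + 1),
      cast_descFactorial_succ s h, aPar, bPar, cPar]
    push_cast
    ring

theorem genRemainder_eq {A : Type*} [CommRing A] (α R : A) (h : ℕ) :
    (PowerSeries.mk fun n => genProd n α R) * (FQ h α R : PowerSeries A)
      - (FP h α R : PowerSeries A) = genRemainder α R h := by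
  induction h using Nat.twoStepInduction with
  | zero =>
    ext n
    simp [FP, FQ, jNum, jDen, genRemainder]
  | one =>
    ext n
    rcases n with _ | n
    · simp [FP, FQ, jNum, jDen, genRemainder, genProd]
    -- This is `p_{n+1} - R p_n = n α p_n`.
    · simp [FP, FQ, jNum, jDen, genRemainder, mul_sub, cPar, ← mul_assoc, PowerSeries.coeff_one,
        PowerSeries.coeff_succ_mul_X, PowerSeries.coeff_mul_C, genProd_succ]
      ring
  | more h ih ih' =>
    rw [genRemainder_add_two, ← ih, ← ih']
    simp only [FP, FQ, jNum, jDen, Polynomial.coe_sub, Polynomial.coe_mul, Polynomial.coe_C,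
      Polynomial.coe_pow, Polynomial.coe_X, Polynomial.coe_one]
    ring

theorem X_pow_dvd_genRemainder {A : Type*} [CommRing A] (α R : A) (h : ℕ) :
    PowerSeries.X ^ (2 * h) ∣ genRemainder α R h := by
  refine PowerSeries.X_pow_dvd_iff.2 fun n hn => ?_
  rw [genRemainder, PowerSeries.coeff_mk, Nat.descFactorial_of_lt (by omega)]
  simp

theorem isJFraction_genProd {A : Type*} [CommRing A] (α R : A) :
    IsJFraction (aPar α R) (bPar A) (cPar α R) (PowerSeries.mk fun n => genProd n α R) := by
  intro n
  filter_upwards [Filter.eventually_ge_atTop (n + 1)] with h hh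
  have hdvd : PowerSeries.X ^ (2 * h) ∣ ((PowerSeries.mk fun n => genProd n α R)
      - jConv (aPar α R) (bPar A) (cPar α R) h) := by
    rw [← (isUnit_jDen (aPar α R) (bPar A) (cPar α R) h).dvd_mul_right, sub_mul, jConv_mul_jDen]
    exact genRemainder_eq α R h ▸ X_pow_dvd_genRemainder α R h
  have := PowerSeries.X_pow_dvd_iff.1 hdvd n (by omega)
  rw [map_sub, sub_eq_zero] at this
  exact this.symm

theorem MPar_dvd_genProd_sub {A : Type*} [CommRing A] (α R : A) (h n : ℕ) :
    MPar α R h ∣ genProd n α R - PowerSeries.coeff n (Conv h α R) := by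
  have hdvd := (isJFraction_genProd α R).jM_dvd h n
  rw [PowerSeries.coeff_mk] at hdvd
  exact hdvd

/-! ### Base change and the ring `ℤ[α, R]`. -/

theorem map_jNum {A B : Type*} [CommRing A] [CommRing B] (f : A →+* B) (a b c : ℕ → A) (h : ℕ) :
    (jNum a b c h).map f = jNum (f ∘ a) (f ∘ b) (f ∘ c) h := by
  induction h using Nat.twoStepInduction with
  | zero => simp [jNum]
  | one => simp [jNum]
  | more h ih ih' => simp [jNum, ih, ih']

theorem map_jDen {A B : Type*} [CommRing A] [CommRing B] (f : A →+* B) (a b c : ℕ → A) (h : ℕ) :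
    (jDen a b c h).map f = jDen (f ∘ a) (f ∘ b) (f ∘ c) h := by
  induction h using Nat.twoStepInduction with
  | zero => simp [jDen]
  | one => simp [jDen]
  | more h ih ih' => simp [jDen, ih, ih']

theorem map_jConv {A B : Type*} [CommRing A] [CommRing B] (f : A →+* B) (a b c : ℕ → A) (h : ℕ) :
    PowerSeries.map f (jConv a b c h) = jConv (f ∘ a) (f ∘ b) (f ∘ c) h := by
  apply (isUnit_jDen (f ∘ a) (f ∘ b) (f ∘ c) h).mul_right_cancel
  rw [jConv_mul_jDen, ← map_jNum, ← map_jDen, Polynomial.polynomial_map_coe,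
    Polynomial.polynomial_map_coe, ← map_mul, jConv_mul_jDen]

theorem map_Conv {A B : Type*} [CommRing A] [CommRing B] (f : A →+* B) (α R : A) (h : ℕ) :
    PowerSeries.map f (Conv h α R) = Conv h (f α) (f R) := by
  rw [Conv, map_jConv, Conv]
  congr 1 <;> funext k <;> simp [aPar, bPar, cPar, map_ofNat f 2]

theorem map_genProd {A B : Type*} [CommRing A] [CommRing B] (f : A →+* B) (n : ℕ) (α R : A) :
    f (genProd n α R) = genProd n (f α) (f R) := by
  simp [genProd, map_prod]

theorem map_MPar {A B : Type*} [CommRing A] [CommRing B] (f : A →+* B) (α R : A) (h : ℕ) :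
    f (MPar α R h) = MPar (f α) (f R) h := by
  simp [MPar_eq, map_genProd]

/-- If `M_h(α, R)` is an integer multiple of `N`, then the congruence modulo `N` holds in the
subring generated by `α` and `R`. -/
theorem exists_mem_adjoin_genProd_sub_eq {K : Type*} [CommRing K] (α R : K) (h : ℕ) (N m : ℤ)
    (hm : MPar α R h = (N : K) * (m : K)) (n : ℕ) :
    ∃ w ∈ Algebra.adjoin ℤ ({α, R} : Set K),
      genProd n α R - PowerSeries.coeff n (Conv h α R) = (N : K) * w := by
  let S := Algebra.adjoin ℤ ({α, R} : Set K)
  let f : S →+* K := S.val.toRingHom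
  let α' : S := ⟨α, Algebra.subset_adjoin (by simp)⟩
  let R' : S := ⟨R, Algebra.subset_adjoin (by simp)⟩
  -- Dividing by `M_h` inside `S` keeps the quotient in `S`; the integer `m` then turns `M_h` into
  -- `N`.
  obtain ⟨w, hw⟩ := MPar_dvd_genProd_sub α' R' h n
  refine ⟨(m : K) * f w, mul_mem (intCast_mem S m) w.2, ?_⟩
  have hf := congrArg f hw
  rw [map_sub, map_mul, map_MPar, map_genProd, ← PowerSeries.coeff_map, map_Conv] at hf
  rw [← mul_assoc, ← hm]
  exact hf

theorem mainTheorem2 {A : Type*} [CommRing A] :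
    -- the congruences for an arbitrary J-fraction
    (∀ a b c : ℕ → A, ∃ F : PowerSeries A, IsJFraction a b c F ∧
      ∀ h : ℕ, 1 ≤ h → ∀ N : A, N ∣ jM a b h → ∀ n : ℕ,
        N ∣ PowerSeries.coeff n F - PowerSeries.coeff n (jConv a b c h)) ∧
    -- the J-fraction of the generalized products
    (∀ α R : A,
      IsJFraction (aPar α R) (bPar A) (cPar α R) (PowerSeries.mk fun n => genProd n α R) ∧
      (∀ k : ℕ, 1 ≤ k → lamPar α R k = α * (R + ((k : A) - 1) * α) * (k : A)) ∧
      ∀ h : ℕ, 1 ≤ h →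
        MPar α R h = α ^ h * (h.factorial : A) * genProd h α R ∧
        (∀ N : A, N ∣ MPar α R h → ∀ n : ℕ,
          N ∣ genProd n α R - PowerSeries.coeff n (Conv h α R)) ∧
        (∀ i : ℕ, i ≤ h → (h : A) * α ^ i ∣ MPar α R h) ∧
        (∀ n : ℕ, (h : A) ∣ genProd n α R - PowerSeries.coeff n (Conv h α R)) ∧
        (∀ i : ℕ, i ≤ h → ∀ n : ℕ,
          (h : A) * α ^ i ∣ genProd n α R - PowerSeries.coeff n (Conv h α R))) ∧
    -- rational parameters and integer moduli: congruences in the ring `ℤ[α, R] ⊆ ℚ`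
    (∀ (α R : ℚ) (h : ℕ), 1 ≤ h → ∀ N : ℤ, (∃ m : ℤ, MPar α R h = (N : ℚ) * (m : ℚ)) →
      ∀ n : ℕ, ∃ w ∈ Algebra.adjoin ℤ ({α, R} : Set ℚ),
        genProd n α R - PowerSeries.coeff n (Conv h α R) = (N : ℚ) * w) := by
  refine ⟨fun a b c => ?_, fun α R => ⟨isJFraction_genProd α R, fun k hk => lamPar_eq α R hk,
    fun h hh => ⟨MPar_eq α R h, fun N hN n => hN.trans (MPar_dvd_genProd_sub α R h n),
      fun i hi => mul_pow_dvd_MPar α R hh hi, fun n => ?_,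
      fun i hi n => (mul_pow_dvd_MPar α R hh hi).trans (MPar_dvd_genProd_sub α R h n)⟩⟩,
    fun α R h _ N ⟨m, hm⟩ n => exists_mem_adjoin_genProd_sub_eq α R h N m hm n⟩
  · obtain ⟨F, hF⟩ := exists_isJFraction a b c
    exact ⟨F, hF, fun h _ N hN n => hN.trans (hF.jM_dvd h n)⟩
  · exact (dvd_of_mul_right_dvd (mul_pow_dvd_MPar α R hh le_rfl)).trans
      (MPar_dvd_genProd_sub α R h n)
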